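/- A line of random length, exponentially distributed with mean $1/\beta$, is walked from its start, and relays are placed on the way. Let $\beta>0$, $\rho>0$, and let $\xi>0$ be the cost of a relay. The resulting total-cost Markov decision process has the states $(0,1]\cup\{\mathbf{EOL}\}$, where $\mathbf{EOL}$ (end of line) is absorbing and free of cost, and the actions $[0,\infty]$ (the distance to the next relay; $\infty$ means that no further relay is placed). In a state $s\in(0,1]$, under the action $a$ and with residual line length $l$, the single-stage cost is $$c(s,a,l)=\begin{cases}\xi+s(e^{\rho a}-1), & l>a,\\ s(e^{\rho l}-1), & l\le a,\end{cases}$$ and the next state is $\dfrac{se^{\rho a}}{1+se^{\rho a}}$, with residual length $l-a$, if $l>a$, and $\mathbf{EOL}$ otherwise. A policy $\pi$ is a sequence of measurable maps $\mu_1,\mu_2,\dots$ from $(0,1]$ to $[0,\infty]$, one for each decision instant, giving the action as a function of the current state. At a decision instant $k$ with $s_k=s\in(0,1]$ the residual length $l_k$ is exponentially distributed with mean $1/\beta$. Let $$V^\pi_\xi(s)=\mathbb{E}_\pi\Big(\sum_{n=k}^\infty c(s_n,a_n,l_n)\,\Big|\,s_k=s\Big)\in[0,\infty],\qquad J_\xi(s)=\inf_\pi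 V^\pi_\xi(s).$$ Then for every $0<a<\infty$ and every $s\in(0,1]$, $$J_\xi(s)<\frac{1}{\beta a}\left(\xi+(e^{\rho a}-1)\right)+(e^{\rho a}-1).$$ Moreover, the policy that always places the next relay at the distance $a$ has an expected cost-to-go $V^\pi_\xi(s)$ that satisfies the same strict bound. -/

import Mathlib

open MeasureTheory ProbabilityTheory
open scoped ENNReal

noncomputable section

namespace RelayMDP

/-- The state space `(0,1] ∪ {EOL}`, where `EOL` ("end of line") is the termination state. -/
inductive State : Type
  | live (s : Set.Ioc (0 : ℝ) 1) : State
  | eol : State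

/-- The action space `[0,∞) ∪ {∞}`: the distance at which the next relay is to be placed;
`∞` means that no further relay is placed. -/
abbrev Action : Type := ℝ≥0∞

/-- A deployment policy: a sequence of (Borel) mappings; the `k`-th one prescribes the action at
the `k`-th decision instant as a function of the current state. No action is taken at `EOL`. -/
structure Policy : Type where
  act : ℕ → Set.Ioc (0 : ℝ) 1 → Action
  measurable_act : ∀ k, Measurable (act k)

/-- The policy that places every next relay at the distance `a` from the current one. -/
def constantSpacing (a : ℝ) : Policy where
  act := fun _ _ => ENNReal.ofReal a
  measurable_act := fun _ => measurable_const

/-- The state `s e^{ρa} / (1 + s e^{ρa})` reached when a relay is placed at distance `a < ∞`. -/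
def relayState (ρ : ℝ) (s : Set.Ioc (0 : ℝ) 1) (a : ℝ) : Set.Ioc (0 : ℝ) 1 :=
  ⟨(s : ℝ) * Real.exp (ρ * a) / (1 + (s : ℝ) * Real.exp (ρ * a)), by
    have h : 0 < (s : ℝ) * Real.exp (ρ * a) := mul_pos s.2.1 (Real.exp_pos _)
    refine ⟨by positivity, ?_⟩
    rw [div_le_one (by positivity)]
    linarith⟩

/-- The state evolution: from the live state `s`, under action `a` and with residual length `l`
of the line, a relay is placed if `l > a`, and otherwise the line ends. -/
def nextState (ρ : ℝ) (s : Set.Ioc (0 : ℝ) 1) (a : Action) (l : ℝ) : State :=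
  if a < ENNReal.ofReal l then State.live (relayState ρ s a.toReal) else State.eol

/-- The single-stage cost `c(s,a,l)` at a live state `s`. -/
def stageCost (ρ ξ : ℝ) (s : Set.Ioc (0 : ℝ) 1) (a : Action) (l : ℝ) : ℝ :=
  if a < ENNReal.ofReal l then ξ + (s : ℝ) * (Real.exp (ρ * a.toReal) - 1)
  else (s : ℝ) * (Real.exp (ρ * l) - 1)

/-- The pair (state, residual length of the line) at the decision instant `k + n` under the
policy `π`, when the state at instant `k` is `s` and the residual length at instant `k` is `l`.
Walking the distance `a` to the next relay reduces the residual length by `a`;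
`EOL` is absorbing. -/
def path (ρ : ℝ) (π : Policy) (k : ℕ) (s : Set.Ioc (0 : ℝ) 1) (l : ℝ) : ℕ → State × ℝ
  | 0 => (State.live s, l)
  | n + 1 =>
    match path ρ π k s l n with
    | (State.live t, r) =>
      (nextState ρ t (π.act (k + n) t) r, r - (π.act (k + n) t).toReal)
    | (State.eol, r) => (State.eol, r)

/-- The cost incurred at the decision instant `k + n`; it is `0` at `EOL`. -/
def costAt (ρ ξ : ℝ) (π : Policy) (k : ℕ) (s : Set.Ioc (0 : ℝ) 1) (l : ℝ) (n : ℕ) : ℝ :=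
  match path ρ π k s l n with
  | (State.live t, r) => stageCost ρ ξ t (π.act (k + n) t) r
  | (State.eol, _) => 0

/-- The expected cost-to-go `E_π (∑_{n ≥ k} c(s_n, a_n, l_n) | s_k = s)`, a value in `[0,∞]`.
The length of the line is exponentially distributed with mean `1/β`, hence so is the residual
length `l_k` at a placement point; all costs are nonnegative. -/
def costToGo (β ρ ξ : ℝ) (π : Policy) (k : ℕ) (s : Set.Ioc (0 : ℝ) 1) : ℝ≥0∞ :=
  ∫⁻ l, ∑' n, ENNReal.ofReal (costAt ρ ξ π k s l n) ∂(expMeasure β)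

/-- The optimal value function `J_ξ(s)`: the infimum over all policies of the expected cost-to-go
from the state `s` at the decision instant `k`. -/
def optimalValue (β ρ ξ : ℝ) (k : ℕ) (s : Set.Ioc (0 : ℝ) 1) : ℝ≥0∞ :=
  ⨅ π : Policy, costToGo β ρ ξ π k s

end RelayMDP

end

/-!
Walk with constant spacing `a` along a line of length `l`, and put `E = e^{ρa} - 1`. Every state is
at most `1`, so each relay placed costs at most `ξ + E`, and the last, incomplete, stretch costs at
most `E`; hence the total cost is at most `(ξ + E) N + E`, where `N` is the number of relays placed.
The `(n + 1)`-st relay is placed exactly when `(n + 1) a < l`, which for an exponential length has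
probability `e^{-(n+1)βa}`. Summing the geometric series gives `𝔼 N = 1 / (e^{βa} - 1)`, and this is
strictly smaller than `1 / (βa)` because `1 + x < e^x` for `x ≠ 0`.
-/

namespace RelayMDP

section Exponential

lemma expMeasure_Ioi {β x : ℝ} (hβ : 0 < β) (hx : 0 ≤ x) :
    expMeasure β (Set.Ioi x) = ENNReal.ofReal (Real.exp (-(β * x))) := by
  have := isProbabilityMeasure_expMeasure hβ
  rw [← measure_cdf (expMeasure β), StieltjesFunction.measure_Ioi _ (tendsto_cdf_atTop _),
    cdf_expMeasure_eq hβ, if_pos hx, sub_sub_cancel]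

lemma hasSum_exp_neg_add_one_mul {x : ℝ} (hx : 0 < x) :
    HasSum (fun n : ℕ => Real.exp (-((n + 1) * x))) (Real.exp x - 1)⁻¹ := by
  have hq : Real.exp (-x) < 1 := Real.exp_lt_one_iff.2 (neg_neg_of_pos hx)
  have hvalue : Real.exp (-x) * (1 - Real.exp (-x))⁻¹ = (Real.exp x - 1)⁻¹ := by
    rw [← inv_inv (Real.exp (-x)), ← mul_inv, ← Real.exp_neg, neg_neg, mul_sub, mul_one,
      mul_inv_cancel₀ (Real.exp_ne_zero x)]
  rw [← hvalue]
  refine ((hasSum_geometric_of_lt_one (Real.exp_pos _).le hq).mul_left _).congr_fun fun n => ?_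
  rw [← Real.exp_nat_mul, ← Real.exp_add]
  ring_nf

end Exponential

section RelayCount

/-- The number of relays that constant spacing `a` places on a line of length `l`: the `(n + 1)`-st
one is placed if and only if `(n + 1) a < l`. It takes values in `ℝ≥0∞` so that its expectation is a
Lebesgue integral. -/
noncomputable def relayCount (a l : ℝ) : ℝ≥0∞ :=
  ∑' n : ℕ, (Set.Ioi ((n + 1) * a)).indicator 1 l

lemma measurable_relayCount (a : ℝ) : Measurable (relayCount a) :=
  Measurable.tsum fun _ => measurable_one.indicator measurableSet_Ioi

lemma lintegral_relayCount (μ : Measure ℝ) (a : ℝ) :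
    ∫⁻ l, relayCount a l ∂μ = ∑' n : ℕ, μ (Set.Ioi ((n + 1) * a)) := by
  simp only [relayCount]
  rw [lintegral_tsum fun _ => (measurable_one.indicator measurableSet_Ioi).aemeasurable]
  exact tsum_congr fun _ => lintegral_indicator_one measurableSet_Ioi

lemma lintegral_relayCount_expMeasure {β a : ℝ} (hβ : 0 < β) (ha : 0 < a) :
    ∫⁻ l, relayCount a l ∂(expMeasure β) = ENNReal.ofReal (Real.exp (β * a) - 1)⁻¹ := by
  have hgeom := hasSum_exp_neg_add_one_mul (mul_pos hβ ha)
  rw [lintegral_relayCount, ← hgeom.tsum_eq,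
    ENNReal.ofReal_tsum_of_nonneg (fun _ => (Real.exp_pos _).le) hgeom.summable]
  refine tsum_congr fun n => ?_
  rw [expMeasure_Ioi hβ (by positivity), mul_left_comm]

end RelayCount

section ConstantSpacing

lemma tsum_indicator_Ioc_succ_le_one {α : Type*} [Preorder α] {f : ℕ → α} (hf : Monotone f)
    (x : α) : ∑' n, (Set.Ioc (f n) (f (n + 1))).indicator (1 : α → ℝ≥0∞) x ≤ 1 := by
  have hdisj : Pairwise (Function.onFun Disjoint fun n => Set.Ioc (f n) (f (n + 1))) :=
    hf.pairwise_disjoint_on_Ioc_succ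
  rw [← congrFun (indicator_iUnion_of_pairwise_disjoint _ hdisj 1) x]
  exact Set.indicator_le_self' (fun _ _ => zero_le) x

variable {ρ ξ a : ℝ}

lemma ofReal_stageCost_ofReal_le (hρ : 0 ≤ ρ) (ha : 0 ≤ a) (s : Set.Ioc (0 : ℝ) 1) (l : ℝ) :
    ENNReal.ofReal (stageCost ρ ξ s (ENNReal.ofReal a) l) ≤
      ENNReal.ofReal (ξ + (Real.exp (ρ * a) - 1)) * (Set.Ioi a).indicator 1 l +
        ENNReal.ofReal (Real.exp (ρ * a) - 1) * (Set.Ioc 0 a).indicator 1 l := by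
  have exp_sub_one_nonneg {x : ℝ} (hx : 0 ≤ x) : 0 ≤ Real.exp (ρ * x) - 1 :=
    sub_nonneg.2 (Real.one_le_exp (mul_nonneg hρ hx))
  simp only [stageCost, ENNReal.ofReal_lt_ofReal_iff_of_nonneg ha, ENNReal.toReal_ofReal ha]
  rcases lt_or_ge a l with hal | hla
  · rw [if_pos hal, Set.indicator_of_mem (Set.mem_Ioi.2 hal), Pi.one_apply, mul_one]
    refine le_add_right (ENNReal.ofReal_le_ofReal ?_)
    gcongr
    exact mul_le_of_le_one_left (exp_sub_one_nonneg ha) s.2.2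
  rw [if_neg hla.not_gt]
  rcases lt_or_ge 0 l with hl | hl
  · rw [Set.indicator_of_mem (Set.mem_Ioc.2 ⟨hl, hla⟩), Pi.one_apply, mul_one]
    refine le_add_left (ENNReal.ofReal_le_ofReal ?_)
    calc (s : ℝ) * (Real.exp (ρ * l) - 1)
        ≤ Real.exp (ρ * l) - 1 := mul_le_of_le_one_left (exp_sub_one_nonneg hl.le) s.2.2
      _ ≤ Real.exp (ρ * a) - 1 := by gcongr
  · have hexp : Real.exp (ρ * l) ≤ 1 := Real.exp_le_one_iff.2 (mul_nonpos_of_nonneg_of_nonpos hρ hl)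
    rw [ENNReal.ofReal_of_nonpos (mul_nonpos_of_nonneg_of_nonpos s.2.1.le (sub_nonpos.2 hexp))]
    exact zero_le

lemma residual_eq_of_path_constantSpacing (ha : 0 ≤ a) {k n : ℕ} {s t : Set.Ioc (0 : ℝ) 1}
    {l r : ℝ} (h : path ρ (constantSpacing a) k s l n = (State.live t, r)) : r = l - n * a := by
  induction n generalizing t r with
  | zero => simp_all [path]
  | succ n ih =>
    rcases hp : path ρ (constantSpacing a) k s l n with ⟨u | _, r'⟩
    · simp only [path, hp] at h
      simp only [constantSpacing, ENNReal.toReal_ofReal ha, Prod.mk.injEq] at h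
      rw [← h.2, ih hp]
      push_cast
      ring
    · simp [path, hp] at h

lemma ofReal_costAt_constantSpacing_le (hρ : 0 ≤ ρ) (ha : 0 ≤ a) (k : ℕ)
    (s : Set.Ioc (0 : ℝ) 1) (l : ℝ) (n : ℕ) :
    ENNReal.ofReal (costAt ρ ξ (constantSpacing a) k s l n) ≤
      ENNReal.ofReal (ξ + (Real.exp (ρ * a) - 1)) * (Set.Ioi ((n + 1) * a)).indicator 1 l +
        ENNReal.ofReal (Real.exp (ρ * a) - 1) *
          (Set.Ioc (n * a) ((n + 1) * a)).indicator 1 l := by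
  rcases hp : path ρ (constantSpacing a) k s l n with ⟨t | _, r⟩
  · obtain rfl := residual_eq_of_path_constantSpacing ha hp
    have hIoi : l - n * a ∈ Set.Ioi a ↔ l ∈ Set.Ioi ((n + 1) * a) := by
      rw [Set.mem_Ioi, Set.mem_Ioi, lt_sub_iff_add_lt, add_one_mul, add_comm]
    have hIoc : l - n * a ∈ Set.Ioc 0 a ↔ l ∈ Set.Ioc (n * a) ((n + 1) * a) := by
      rw [Set.mem_Ioc, Set.mem_Ioc, sub_pos, sub_le_iff_le_add', add_one_mul]
    have hstage := ofReal_stageCost_ofReal_le (ξ := ξ) hρ ha t (l - n * a)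
    simp only [Set.indicator_apply, hIoi, hIoc, Pi.one_apply] at hstage ⊢
    simp only [costAt, hp]
    exact hstage
  · simp [costAt, hp]

lemma tsum_costAt_constantSpacing_le (hρ : 0 ≤ ρ) (ha : 0 ≤ a) (k : ℕ)
    (s : Set.Ioc (0 : ℝ) 1) (l : ℝ) :
    ∑' n, ENNReal.ofReal (costAt ρ ξ (constantSpacing a) k s l n) ≤
      ENNReal.ofReal (ξ + (Real.exp (ρ * a) - 1)) * relayCount a l +
        ENNReal.ofReal (Real.exp (ρ * a) - 1) := by
  have hmono : Monotone fun n : ℕ => n * a := fun m n hmn => by dsimp only; gcongr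
  have hlast : ∑' n : ℕ, (Set.Ioc (n * a) ((n + 1) * a)).indicator (1 : ℝ → ℝ≥0∞) l ≤ 1 := by
    simpa only [Nat.cast_add_one] using tsum_indicator_Ioc_succ_le_one hmono l
  refine (ENNReal.tsum_le_tsum fun n => ofReal_costAt_constantSpacing_le hρ ha k s l n).trans ?_
  rw [ENNReal.tsum_add, ENNReal.tsum_mul_left, ENNReal.tsum_mul_left, ← relayCount]
  gcongr
  exact mul_le_of_le_one_right' hlast

lemma lintegral_tsum_costAt_constantSpacing_le (hρ : 0 ≤ ρ) (ha : 0 ≤ a) (k : ℕ)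
    (s : Set.Ioc (0 : ℝ) 1) (μ : Measure ℝ) [IsProbabilityMeasure μ] :
    ∫⁻ l, ∑' n, ENNReal.ofReal (costAt ρ ξ (constantSpacing a) k s l n) ∂μ ≤
      ENNReal.ofReal (ξ + (Real.exp (ρ * a) - 1)) * ∫⁻ l, relayCount a l ∂μ +
        ENNReal.ofReal (Real.exp (ρ * a) - 1) := by
  refine (lintegral_mono fun l => tsum_costAt_constantSpacing_le hρ ha k s l).trans_eq ?_
  rw [lintegral_add_right _ measurable_const, lintegral_const, measure_univ, mul_one,
    lintegral_const_mul _ (measurable_relayCount a)]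

lemma costToGo_constantSpacing_le {β : ℝ} (hβ : 0 < β) (hρ : 0 ≤ ρ) (hξ : 0 ≤ ξ) (ha : 0 < a)
    (k : ℕ) (s : Set.Ioc (0 : ℝ) 1) :
    costToGo β ρ ξ (constantSpacing a) k s ≤
      ENNReal.ofReal ((ξ + (Real.exp (ρ * a) - 1)) / (Real.exp (β * a) - 1) +
        (Real.exp (ρ * a) - 1)) := by
  have := isProbabilityMeasure_expMeasure hβ
  have hE : 0 ≤ Real.exp (ρ * a) - 1 := sub_nonneg.2 (Real.one_le_exp (by positivity))
  have hB : 0 ≤ Real.exp (β * a) - 1 := sub_nonneg.2 (Real.one_le_exp (by positivity))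
  rw [ENNReal.ofReal_add (by positivity) hE, div_eq_mul_inv, ENNReal.ofReal_mul (by positivity),
    ← lintegral_relayCount_expMeasure hβ ha]
  exact lintegral_tsum_costAt_constantSpacing_le hρ ha.le k s (expMeasure β)

end ConstantSpacing

lemma optimalValue_le_costToGo (β ρ ξ : ℝ) (π : Policy) (k : ℕ) (s : Set.Ioc (0 : ℝ) 1) :
    optimalValue β ρ ξ k s ≤ costToGo β ρ ξ π k s :=
  iInf_le _ π

end RelayMDP

theorem mainTheorem12 (β ρ ξ a : ℝ) (hβ : 0 < β) (hρ : 0 < ρ) (hξ : 0 < ξ) (ha : 0 < a)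
    (k : ℕ) (s : Set.Ioc (0 : ℝ) 1) :
    RelayMDP.costToGo β ρ ξ (RelayMDP.constantSpacing a) k s
        < ENNReal.ofReal ((ξ + (Real.exp (ρ * a) - 1)) / (β * a) + (Real.exp (ρ * a) - 1)) ∧
      RelayMDP.optimalValue β ρ ξ k s
        < ENNReal.ofReal ((ξ + (Real.exp (ρ * a) - 1)) / (β * a) + (Real.exp (ρ * a) - 1)) := by
  have hβa : 0 < β * a := mul_pos hβ ha
  have hE : 0 < Real.exp (ρ * a) - 1 := sub_pos.2 (Real.one_lt_exp_iff.2 (mul_pos hρ ha))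
  have hcost : RelayMDP.costToGo β ρ ξ (RelayMDP.constantSpacing a) k s
      < ENNReal.ofReal ((ξ + (Real.exp (ρ * a) - 1)) / (β * a) + (Real.exp (ρ * a) - 1)) := by
    refine (RelayMDP.costToGo_constantSpacing_le hβ hρ.le hξ.le ha k s).trans_lt ?_
    rw [ENNReal.ofReal_lt_ofReal_iff (by positivity)]
    gcongr
    exact lt_sub_iff_add_lt.2 (Real.add_one_lt_exp hβa.ne')
  exact ⟨hcost, (RelayMDP.optimalValue_le_costToGo β ρ ξ _ k s).trans_lt hcost⟩
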